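/- Let $m\ge 1$ and let $S_0,\dots,S_m:\mathbb R\to\mathbb R$ be similarities with a common contraction factor $\rho\in(0,1)$, i.e. $|S_j(x)-S_j(y)|=\rho|x-y|$ for all $x,y\in\mathbb R$ and all $j$. For a word $w=(j_1,\dots,j_n)$ on $\{0,\dots,m\}$ put $S_w=S_{j_1}\circ\cdots\circ S_{j_n}$, and let $K$ be the self-similar set of the system, i.e. the unique non-empty compact set with $K=\bigcup_{j}S_j(K)$. Assume that the system is of finite type: there is a finite set $F\subseteq\mathbb R$ such that for every $n$ and all words $v,w$ of length $n$, either $|S_v(0)-S_w(0)|>\rho^n\operatorname{diam}K$ or $\rho^{-n}|S_v(0)-S_w(0)|\in F$. Let $p_0,\dots,p_m>0$ with $\sum_j p_j=1$, and let $\mu$ be the associated self-similar measure, i.e. the unique Borel probability measure on $\mathbb R$ with $\mu(E)=\sum_{j}p_j\,\mu(S_j^{-1}(E))$ for all Borel sets $E$. Assume that $\operatorname{supp}\mu=[0,1]$. Then for every constant dimension function $\Phi=\delta>0$ the upper $\Phi$-dimension of $\mu$ satisfies $\overline{\dim}_\Phi\mu<\infty$. Here a dimension function is a map $\Phi:(0,1)\to[0,\infty)$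 such that $x^{1+\Phi(x)}$ decreases to $0$ as $x$ decreases to $0$, and $\overline{\dim}_\Phi\mu$ is the infimum (equal to $+\infty$ if there is no such $\alpha$) of all $\alpha\in\mathbb R$ for which there are constants $C_1,C_2>0$ such that $$\frac{\mu(B(x,R))}{\mu(B(x,r))}\le C_2\left(\frac Rr\right)^{\alpha}$$ for all $x\in\operatorname{supp}\mu$, all $R\in(0,1)$ and all $r$ with $0<r<R^{1+\Phi(R)}\le R\le C_1$, where $B(x,R)$ denotes the open ball. -/

import Mathlib

namespace PhiDim

open Set Filter Topology MeasureTheory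

/-- A dimension function: a map `Φ : (0,1) → [0,∞)` such that `x ^ (1 + Φ x)` decreases to `0`
as `x` decreases to `0`. -/
structure DimensionFunction where
  toFun : Ioo (0 : ℝ) 1 → ℝ
  nonneg : ∀ x, 0 ≤ toFun x
  monotone : Monotone fun x : Ioo (0 : ℝ) 1 => (x : ℝ) ^ (1 + toFun x)
  tendsto_zero : Tendsto (fun x : Ioo (0 : ℝ) 1 => (x : ℝ) ^ (1 + toFun x))
    (comap ((↑) : Ioo (0 : ℝ) 1 → ℝ) (𝓝 0)) (𝓝 0)

/-- The constant dimension function `Φ = δ`, for `δ ≥ 0`. -/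
def DimensionFunction.const (δ : ℝ) (hδ : 0 ≤ δ) : DimensionFunction where
  toFun := fun _ => δ
  nonneg := fun _ => hδ
  monotone := fun x y hxy => by
    have hx : (0 : ℝ) ≤ x := x.2.1.le
    have hxy' : (x : ℝ) ≤ y := hxy
    exact Real.rpow_le_rpow hx hxy' (by linarith)
  tendsto_zero := by
    have h : Tendsto (fun t : ℝ => t ^ (1 + δ)) (𝓝 0) (𝓝 ((0 : ℝ) ^ (1 + δ))) :=
      (Real.continuousAt_rpow_const 0 (1 + δ) (Or.inr (by linarith))).tendsto
    rw [Real.zero_rpow (by linarith)] at h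
    exact h.comp tendsto_comap

/-- The upper `Φ`-dimension of a measure: the infimum, in the extended reals, of the real `α` for
which there are `C₁, C₂ > 0` with `μ (B(x,R)) / μ (B(x,r)) ≤ C₂ (R/r) ^ α` for all
`0 < r < R ^ (1 + Φ R) ≤ R ≤ C₁` and all `x` in the support of `μ`. It is `⊤` if there is no
such `α`. -/
noncomputable def upperPhiDim {X : Type*} [MetricSpace X] [MeasurableSpace X]
    (Φ : DimensionFunction) (μ : Measure X) : EReal :=
  sInf {a : EReal | ∃ α : ℝ, a = (α : EReal) ∧
    ∃ C₁ : ℝ, 0 < C₁ ∧ ∃ C₂ : ℝ, 0 < C₂ ∧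
      ∀ (R : Ioo (0 : ℝ) 1) (r : ℝ), 0 < r → r < (R : ℝ) ^ (1 + Φ.toFun R) →
        (R : ℝ) ^ (1 + Φ.toFun R) ≤ R → (R : ℝ) ≤ C₁ →
        ∀ x ∈ μ.support,
          μ.real (Metric.ball x R) / μ.real (Metric.ball x r) ≤ C₂ * ((R : ℝ) / r) ^ α}

/-- An iterated function system `S_0, …, S_m` of contracting similarities of `X`. -/
structure SimilarityIFS (X : Type*) [MetricSpace X] (m : ℕ) where
  map : Fin (m + 1) → X → X
  ratio : Fin (m + 1) → ℝ
  ratio_pos : ∀ j, 0 < ratio j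
  ratio_lt_one : ∀ j, ratio j < 1
  dist_map : ∀ j x y, dist (map j x) (map j y) = ratio j * dist x y

namespace SimilarityIFS

variable {X : Type*} [MetricSpace X] {m : ℕ}

/-- `S_w = S_{j_1} ∘ ⋯ ∘ S_{j_n}` for the word `w = (j_1, …, j_n)`. -/
def wordMap (S : SimilarityIFS X m) : List (Fin (m + 1)) → X → X
  | [] => id
  | j :: w => S.map j ∘ S.wordMap w

/-- All the similarities have the same contraction factor `ρ`. -/
def IsEquicontractive (S : SimilarityIFS X m) (ρ : ℝ) : Prop :=
  ∀ j, S.ratio j = ρ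

/-- `K` is the self-similar set of the IFS. -/
def IsSelfSimilarSet (S : SimilarityIFS X m) (K : Set X) : Prop :=
  K.Nonempty ∧ IsCompact K ∧ K = ⋃ j, S.map j '' K

/-- `μ` is the self-similar measure of the IFS `S` and the probabilities `p`. -/
structure IsSelfSimilarMeasure [MeasurableSpace X] (S : SimilarityIFS X m)
    (p : Fin (m + 1) → ℝ) (μ : Measure X) : Prop where
  prob_pos : ∀ j, 0 < p j
  sum_prob : ∑ j, p j = 1
  isProbabilityMeasure : IsProbabilityMeasure μ
  measure_eq : ∀ E : Set X, MeasurableSet E →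
    μ E = ∑ j, ENNReal.ofReal (p j) * μ (S.map j ⁻¹' E)

/-- The finite type condition, for an IFS on `ℝ` whose maps all have contraction factor `ρ`. -/
def IsFiniteType (S : SimilarityIFS ℝ m) (ρ : ℝ) : Prop :=
  ∃ K : Set ℝ, S.IsSelfSimilarSet K ∧ ∃ F : Set ℝ, F.Finite ∧
    ∀ (n : ℕ) (v w : List (Fin (m + 1))), v.length = n → w.length = n →
      Metric.diam K * ρ ^ n < |S.wordMap v 0 - S.wordMap w 0| ∨
        (ρ ^ n)⁻¹ * |S.wordMap v 0 - S.wordMap w 0| ∈ F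

end SimilarityIFS

end PhiDim

/-!
Let `ρ < 1` bound the ratios of the system. If `a` is a point and `M` is so large that every map
sends the ball `B(a, M + t)` into `B(a, M + ρ t)`, then the mass outside `B(a, M + ρ ^ n t)` is at
most the mass outside `B(a, M + t)`; taking `t = ρ ^ (-n)` and letting `n → ∞` shows that `μ` is
carried by the bounded set `A = B(a, M + 1)`. A ball about a point of the support has positive
measure, so for each `n` some `S_w` with `|w| = n` sends a point of `A` close to the centre, and
hence all of `A` into a ball of radius comparable to `ρ ^ n`. This ball then has mass at least
`p_w ≥ (min p) ^ n`, a fixed power of `ρ ^ n`. As `r < R ^ (1 + δ)` gives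
`r ^ (-1) ≤ (R / r) ^ ((1 + δ) / δ)`, such a lower bound on the masses of balls forces the upper
`Φ`-dimension to be finite.
-/

namespace PhiDim

open Set Filter Topology MeasureTheory Metric

theorem tendsto_measureReal_compl_closedBall_atTop {X : Type*} [PseudoMetricSpace X]
    [MeasurableSpace X] [OpensMeasurableSpace X] (μ : Measure X) [IsFiniteMeasure μ] (a : X) :
    Tendsto (fun t : ℝ => μ.real (closedBall a t)ᶜ) atTop (𝓝 0) := by
  have hinter : ⋂ t : ℝ, (closedBall a t)ᶜ = ∅ :=
    eq_empty_of_forall_notMem fun x hx => mem_iInter.1 hx (dist x a) (mem_closedBall.2 le_rfl)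
  have hlim : Tendsto (fun t : ℝ => μ (closedBall a t)ᶜ) atTop
      (𝓝 (μ (⋂ t : ℝ, (closedBall a t)ᶜ))) :=
    tendsto_measure_iInter_atTop
      (fun _ => isClosed_closedBall.measurableSet.compl.nullMeasurableSet)
      (fun _ _ hst => compl_subset_compl.2 (closedBall_subset_closedBall hst))
      ⟨0, measure_ne_top _ _⟩
  rw [hinter, measure_empty] at hlim
  exact (ENNReal.tendsto_toReal ENNReal.zero_ne_top).comp hlim

theorem exists_nat_mul_pow_lt_and_mul_rpow_le_pow {ρ q D : ℝ} (hρ₀ : 0 < ρ) (hρ₁ : ρ < 1)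
    (hq₀ : 0 < q) (hq₁ : q ≤ 1) :
    ∃ c : ℝ, 0 < c ∧ ∃ s : ℝ, 0 ≤ s ∧ ∀ r : ℝ, 0 < r → r ≤ 1 →
      ∃ n : ℕ, D * ρ ^ n < r ∧ c * r ^ s ≤ q ^ n := by
  set E := max D 1
  have hE : 1 ≤ E := le_max_right D 1
  have hE₀ : 0 < E := one_pos.trans_le hE
  set s := Real.logb ρ q
  have hs : 0 ≤ s := Real.logb_nonneg_of_base_lt_one hρ₀ hρ₁ hq₀ hq₁
  refine ⟨q / E ^ s, by positivity, s, hs, fun r hr₀ hr₁ => ?_⟩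
  obtain ⟨n, hlt, hle⟩ := exists_nat_pow_near_of_lt_one (div_pos hr₀ hE₀)
    ((div_le_one hE₀).2 (hr₁.trans hE)) hρ₀ hρ₁
  refine ⟨n + 1, ?_, ?_⟩
  · calc D * ρ ^ (n + 1) ≤ E * ρ ^ (n + 1) := by gcongr; exact le_max_left D 1
      _ < r := (lt_div_iff₀' hE₀).1 hlt
  · calc q / E ^ s * r ^ s = q * (r / E) ^ s := by rw [Real.div_rpow hr₀.le hE₀.le]; ring
      _ ≤ q * (ρ ^ n) ^ s := by gcongr
      _ = q * (ρ ^ s) ^ n := by rw [Real.rpow_pow_comm hρ₀.le]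
      _ = q ^ (n + 1) := by rw [Real.rpow_logb hρ₀ hρ₁.ne hq₀, pow_succ']

namespace SimilarityIFS

variable {X : Type*} [MetricSpace X] {m : ℕ}

theorem exists_forall_ratio_le (S : SimilarityIFS X m) :
    ∃ ρ : ℝ, 0 < ρ ∧ ρ < 1 ∧ ∀ j, S.ratio j ≤ ρ :=
  let ⟨i, hi⟩ := Finite.exists_max S.ratio
  ⟨S.ratio i, S.ratio_pos i, S.ratio_lt_one i, hi⟩

theorem continuous_map (S : SimilarityIFS X m) (j : Fin (m + 1)) : Continuous (S.map j) :=
  (LipschitzWith.of_dist_le' fun x y => (S.dist_map j x y).le).continuous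

theorem dist_wordMap_le (S : SimilarityIFS X m) {ρ : ℝ} (hρ : ∀ j, S.ratio j ≤ ρ)
    (w : List (Fin (m + 1))) (x y : X) :
    dist (S.wordMap w x) (S.wordMap w y) ≤ ρ ^ w.length * dist x y := by
  induction w with
  | nil => simp [wordMap]
  | cons j w ih =>
    have hρ₀ : 0 ≤ ρ := (S.ratio_pos j).le.trans (hρ j)
    calc dist (S.wordMap (j :: w) x) (S.wordMap (j :: w) y)
        = S.ratio j * dist (S.wordMap w x) (S.wordMap w y) := S.dist_map j _ _
      _ ≤ ρ * (ρ ^ w.length * dist x y) := mul_le_mul (hρ j) ih dist_nonneg hρ₀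
      _ = ρ ^ (j :: w).length * dist x y := by rw [List.length_cons]; ring

theorem mapsTo_map_closedBall_add (S : SimilarityIFS X m) {ρ : ℝ} {j : Fin (m + 1)} {a : X}
    {M t : ℝ} (hρ : S.ratio j ≤ ρ) (hM : dist (S.map j a) a ≤ (1 - ρ) * M) :
    MapsTo (S.map j) (closedBall a (M + t)) (closedBall a (M + ρ * t)) := fun x hx => by
  have hρ₀ : 0 ≤ ρ := (S.ratio_pos j).le.trans hρ
  calc dist (S.map j x) a ≤ dist (S.map j x) (S.map j a) + dist (S.map j a) a :=
        dist_triangle _ _ _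
    _ ≤ ρ * (M + t) + (1 - ρ) * M := by
        rw [S.dist_map]
        exact add_le_add (mul_le_mul hρ hx dist_nonneg hρ₀) hM
    _ = M + ρ * t := by ring

namespace IsSelfSimilarMeasure

variable [MeasurableSpace X] {S : SimilarityIFS X m} {p : Fin (m + 1) → ℝ} {μ : Measure X}

theorem prob_le_one (hμ : S.IsSelfSimilarMeasure p μ) (j : Fin (m + 1)) : p j ≤ 1 :=
  hμ.sum_prob ▸ Finset.single_le_sum (fun i _ => (hμ.prob_pos i).le) (Finset.mem_univ j)

theorem measureReal_eq (hμ : S.IsSelfSimilarMeasure p μ) {E : Set X} (hE : MeasurableSet E) :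
    μ.real E = ∑ j, p j * μ.real (S.map j ⁻¹' E) := by
  have := hμ.isProbabilityMeasure
  rw [measureReal_def, hμ.measure_eq E hE,
    ENNReal.toReal_sum fun j _ => ENNReal.mul_ne_top ENNReal.ofReal_ne_top (measure_ne_top _ _)]
  simp only [ENNReal.toReal_mul, ENNReal.toReal_ofReal (hμ.prob_pos _).le, measureReal_def]

theorem measureReal_le_of_preimage_subset (hμ : S.IsSelfSimilarMeasure p μ) {E F : Set X}
    (hE : MeasurableSet E) (hEF : ∀ j, S.map j ⁻¹' E ⊆ F) : μ.real E ≤ μ.real F := by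
  have := hμ.isProbabilityMeasure
  calc μ.real E = ∑ j, p j * μ.real (S.map j ⁻¹' E) := hμ.measureReal_eq hE
    _ ≤ ∑ j, p j * μ.real F := Finset.sum_le_sum fun j _ =>
        mul_le_mul_of_nonneg_left (measureReal_mono (hEF j)) (hμ.prob_pos j).le
    _ = μ.real F := by rw [← Finset.sum_mul, hμ.sum_prob, one_mul]

theorem measureReal_compl_closedBall_add_pow_mul_le [OpensMeasurableSpace X]
    (hμ : S.IsSelfSimilarMeasure p μ) {ρ : ℝ} (hρ : ∀ j, S.ratio j ≤ ρ) {a : X} {M : ℝ}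
    (hM : ∀ j, dist (S.map j a) a ≤ (1 - ρ) * M) (t : ℝ) (n : ℕ) :
    μ.real (closedBall a (M + ρ ^ n * t))ᶜ ≤ μ.real (closedBall a (M + t))ᶜ := by
  induction n with
  | zero => rw [pow_zero, one_mul]
  | succ n ih =>
    refine le_trans ?_ ih
    rw [pow_succ', mul_assoc]
    exact hμ.measureReal_le_of_preimage_subset isClosed_closedBall.measurableSet.compl
      fun j _ hx hball => hx (S.mapsTo_map_closedBall_add (hρ j) (hM j) hball)

theorem exists_isBounded_mem_ae [OpensMeasurableSpace X] (hμ : S.IsSelfSimilarMeasure p μ) :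
    ∃ A : Set X, Bornology.IsBounded A ∧ A ∈ ae μ := by
  have := hμ.isProbabilityMeasure
  obtain ⟨a⟩ := μ.nonempty_of_neZero
  obtain ⟨ρ, hρ₀, hρ₁, hρ⟩ := S.exists_forall_ratio_le
  obtain ⟨i, hi⟩ := Finite.exists_max fun j => dist (S.map j a) a
  set M := dist (S.map i a) a / (1 - ρ)
  have hM : ∀ j, dist (S.map j a) a ≤ (1 - ρ) * M := fun j =>
    (hi j).trans_eq (mul_div_cancel₀ _ (sub_pos.2 hρ₁).ne').symm
  have hle : ∀ n : ℕ, μ.real (closedBall a (M + 1))ᶜ ≤ μ.real (closedBall a (M + ρ⁻¹ ^ n))ᶜ :=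
    fun n => by
      simpa only [inv_pow, mul_inv_cancel₀ (pow_pos hρ₀ n).ne']
        using hμ.measureReal_compl_closedBall_add_pow_mul_le hρ hM (ρ⁻¹ ^ n) n
  have hlim : Tendsto (fun n : ℕ => μ.real (closedBall a (M + ρ⁻¹ ^ n))ᶜ) atTop (𝓝 0) :=
    (tendsto_measureReal_compl_closedBall_atTop μ a).comp <| tendsto_atTop_add_const_left _ M <|
      tendsto_pow_atTop_atTop_of_one_lt ((one_lt_inv₀ hρ₀).2 hρ₁)
  have hzero : μ.real (closedBall a (M + 1))ᶜ = 0 :=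
    (ge_of_tendsto' hlim hle).antisymm measureReal_nonneg
  exact ⟨closedBall a (M + 1), isBounded_closedBall,
    mem_ae_iff.2 ((measureReal_eq_zero_iff (measure_ne_top _ _)).1 hzero)⟩

variable [BorelSpace X]

theorem pow_mul_measureReal_preimage_wordMap_le (hμ : S.IsSelfSimilarMeasure p μ) {q : ℝ}
    (hq₀ : 0 ≤ q) (hq : ∀ j, q ≤ p j) (w : List (Fin (m + 1))) {E : Set X}
    (hE : MeasurableSet E) : q ^ w.length * μ.real (S.wordMap w ⁻¹' E) ≤ μ.real E := by
  induction w generalizing E with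
  | nil => simp [wordMap]
  | cons j w ih =>
    calc q ^ (j :: w).length * μ.real (S.wordMap (j :: w) ⁻¹' E)
        = q * (q ^ w.length * μ.real (S.wordMap w ⁻¹' (S.map j ⁻¹' E))) := by
          rw [List.length_cons, pow_succ', mul_assoc]; rfl
      _ ≤ p j * μ.real (S.map j ⁻¹' E) :=
          mul_le_mul (hq j) (ih ((S.continuous_map j).measurable hE)) (by positivity)
            (hμ.prob_pos j).le
      _ ≤ ∑ i, p i * μ.real (S.map i ⁻¹' E) :=
          Finset.single_le_sum (f := fun i => p i * μ.real (S.map i ⁻¹' E))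
            (fun i _ => mul_nonneg (hμ.prob_pos i).le measureReal_nonneg) (Finset.mem_univ j)
      _ = μ.real E := (hμ.measureReal_eq hE).symm

theorem exists_length_eq_measure_preimage_wordMap_ne_zero (hμ : S.IsSelfSimilarMeasure p μ)
    (n : ℕ) {E : Set X} (hE : MeasurableSet E) (hpos : μ E ≠ 0) :
    ∃ w : List (Fin (m + 1)), w.length = n ∧ μ (S.wordMap w ⁻¹' E) ≠ 0 := by
  induction n generalizing E with
  | zero => exact ⟨[], rfl, hpos⟩
  | succ n ih =>
    obtain ⟨j, -, hj⟩ := Finset.exists_ne_zero_of_sum_ne_zero (hμ.measure_eq E hE ▸ hpos)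
    obtain ⟨w, hw, hwE⟩ := ih ((S.continuous_map j).measurable hE) (right_ne_zero_of_mul hj)
    exact ⟨j :: w, congrArg (· + 1) hw, hwE⟩

theorem pow_le_measureReal_ball (hμ : S.IsSelfSimilarMeasure p μ) {ρ q : ℝ}
    (hρ : ∀ j, S.ratio j ≤ ρ) (hq₀ : 0 ≤ q) (hq : ∀ j, q ≤ p j) {A : Set X}
    (hbdd : Bornology.IsBounded A) (hA : A ∈ ae μ) {x : X} (hx : x ∈ μ.support) {r : ℝ} {n : ℕ}
    (hr : diam A * ρ ^ n < r) : q ^ n ≤ μ.real (ball x r) := by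
  have := hμ.isProbabilityMeasure
  have hρ₀ : 0 ≤ ρ := (S.ratio_pos 0).le.trans (hρ 0)
  have hpos : μ (ball x (r - diam A * ρ ^ n)) ≠ 0 :=
    ((Measure.mem_support_iff_forall x).1 hx _ (ball_mem_nhds x (sub_pos.2 hr))).ne'
  obtain ⟨w, rfl, hw⟩ := hμ.exists_length_eq_measure_preimage_wordMap_ne_zero n
    measurableSet_ball hpos
  obtain ⟨z, hzx, hz⟩ := ((frequently_ae_mem_iff.2 hw).and_eventually hA).exists
  have hball : A ⊆ S.wordMap w ⁻¹' ball x r := fun y hy => by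
    calc dist (S.wordMap w y) x
        ≤ dist (S.wordMap w y) (S.wordMap w z) + dist (S.wordMap w z) x := dist_triangle _ _ _
      _ < ρ ^ w.length * diam A + (r - diam A * ρ ^ w.length) :=
          add_lt_add_of_le_of_lt ((S.dist_wordMap_le hρ w y z).trans
            (mul_le_mul_of_nonneg_left (dist_le_diam_of_mem hbdd hy hz) (by positivity))) hzx
      _ = r := by ring
  have hfull : μ.real (S.wordMap w ⁻¹' ball x r) = 1 := by
    rw [measureReal_congr (eventuallyEq_univ.2 (mem_of_superset hA hball)), probReal_univ]
  simpa only [hfull, mul_one] using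
    hμ.pow_mul_measureReal_preimage_wordMap_le hq₀ hq w (measurableSet_ball (x := x) (ε := r))

theorem exists_mul_rpow_le_measureReal_ball (hμ : S.IsSelfSimilarMeasure p μ) :
    ∃ c : ℝ, 0 < c ∧ ∃ s : ℝ, 0 ≤ s ∧ ∀ x ∈ μ.support, ∀ r : ℝ, 0 < r → r ≤ 1 →
      c * r ^ s ≤ μ.real (ball x r) := by
  obtain ⟨ρ, hρ₀, hρ₁, hρ⟩ := S.exists_forall_ratio_le
  obtain ⟨i, hi⟩ := Finite.exists_min p
  obtain ⟨A, hbdd, hA⟩ := hμ.exists_isBounded_mem_ae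
  obtain ⟨c, hc, s, hs, hcs⟩ := exists_nat_mul_pow_lt_and_mul_rpow_le_pow (D := diam A) hρ₀ hρ₁
    (hμ.prob_pos i) (hμ.prob_le_one i)
  refine ⟨c, hc, s, hs, fun x hx r hr₀ hr₁ => ?_⟩
  obtain ⟨n, hn, hcn⟩ := hcs r hr₀ hr₁
  exact hcn.trans
    (hμ.pow_le_measureReal_ball hρ (hμ.prob_pos i).le hi hbdd hA hx hn)

end IsSelfSimilarMeasure

end SimilarityIFS

theorem rpow_neg_le_div_rpow {R r δ s : ℝ} (hR : 0 < R) (hr : 0 < r) (hδ : 0 < δ) (hs : 0 ≤ s)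
    (h : r ≤ R ^ (1 + δ)) : r ^ (-s) ≤ (R / r) ^ ((1 + δ) * (s / δ)) := by
  have hbase : r ^ (-δ) ≤ (R / r) ^ (1 + δ) := by
    rw [Real.div_rpow hR.le hr.le, le_div_iff₀ (by positivity), ← Real.rpow_add hr]
    simpa using h
  calc r ^ (-s) = (r ^ (-δ)) ^ (s / δ) := by
        rw [← Real.rpow_mul hr.le]
        congr 1
        field_simp
    _ ≤ ((R / r) ^ (1 + δ)) ^ (s / δ) := by gcongr
    _ = (R / r) ^ ((1 + δ) * (s / δ)) := (Real.rpow_mul (by positivity) _ _).symm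

theorem upperPhiDim_lt_top_of_rpow_le_measureReal_ball {X : Type*} [MetricSpace X]
    [MeasurableSpace X] {μ : Measure X} [IsFiniteMeasure μ] {c s : ℝ} (hc : 0 < c) (hs : 0 ≤ s)
    (hmass : ∀ x ∈ μ.support, ∀ r : ℝ, 0 < r → r ≤ 1 → c * r ^ s ≤ μ.real (ball x r))
    {Φ : DimensionFunction} {δ : ℝ} (hδ : 0 < δ)
    (hΦ : ∀ᶠ R in comap ((↑) : Ioo (0 : ℝ) 1 → ℝ) (𝓝 0), δ ≤ Φ.toFun R) :
    upperPhiDim Φ μ < ⊤ := by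
  obtain ⟨C₁, hC₁, hΦC₁⟩ := (nhds_basis_closedBall.comap _).eventually_iff.1 hΦ
  set C₂ := (μ.real univ + 1) / c
  have hC₂ : 0 < C₂ := by positivity
  refine lt_of_le_of_lt (sInf_le ⟨(1 + δ) * (s / δ), rfl, C₁, hC₁, C₂, hC₂, ?_⟩)
    (EReal.coe_lt_top _)
  intro R r hr hrR hRR hRC₁ x hx
  have hδR : δ ≤ Φ.toFun R :=
    hΦC₁ (by simpa [abs_of_pos R.2.1] using hRC₁)
  have hrδ : r ≤ (R : ℝ) ^ (1 + δ) := hrR.le.trans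
    (Real.rpow_le_rpow_of_exponent_ge R.2.1 R.2.2.le (by gcongr))
  calc μ.real (ball x R) / μ.real (ball x r) ≤ (μ.real univ + 1) / (c * r ^ s) :=
        div_le_div₀ (by positivity) ((measureReal_mono (subset_univ _)).trans (by simp))
          (by positivity) (hmass x hx r hr ((hrR.le.trans hRR).trans R.2.2.le))
    _ = C₂ * r ^ (-s) := by rw [Real.rpow_neg hr.le, div_mul_eq_div_div, div_eq_mul_inv _ (r ^ s)]
    _ ≤ C₂ * ((R : ℝ) / r) ^ ((1 + δ) * (s / δ)) := by
        gcongr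
        exact rpow_neg_le_div_rpow R.2.1 hr hδ hs hrδ

end PhiDim

theorem mainTheorem10_general {X : Type*} [MetricSpace X] [MeasurableSpace X] [BorelSpace X]
    {m : ℕ} {S : PhiDim.SimilarityIFS X m} {p : Fin (m + 1) → ℝ} {μ : MeasureTheory.Measure X}
    (hμ : S.IsSelfSimilarMeasure p μ) {Φ : PhiDim.DimensionFunction} {δ : ℝ} (hδ : 0 < δ)
    (hΦ : ∀ᶠ R in Filter.comap ((↑) : Set.Ioo (0 : ℝ) 1 → ℝ) (nhds 0), δ ≤ Φ.toFun R) :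
    PhiDim.upperPhiDim Φ μ < ⊤ := by
  have := hμ.isProbabilityMeasure
  obtain ⟨c, hc, s, hs, hmass⟩ := hμ.exists_mul_rpow_le_measureReal_ball
  exact PhiDim.upperPhiDim_lt_top_of_rpow_le_measureReal_ball hc hs hmass hδ hΦ

theorem mainTheorem10 {m : ℕ} (hm : 1 ≤ m) (S : PhiDim.SimilarityIFS ℝ m) (ρ : ℝ)
    (hS : S.IsEquicontractive ρ) (hF : S.IsFiniteType ρ)
    (p : Fin (m + 1) → ℝ) (μ : MeasureTheory.Measure ℝ) (hμ : S.IsSelfSimilarMeasure p μ)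
    (hsupp : μ.support = Set.Icc (0 : ℝ) 1) (δ : ℝ) (hδ : 0 < δ) :
    PhiDim.upperPhiDim (PhiDim.DimensionFunction.const δ hδ.le) μ < ⊤ :=
  mainTheorem10_general hμ hδ (.of_forall fun _ => le_rfl)
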